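/- Let $k \ge 1$. A $k$-player alternating move game is given by finite action sets $A_1,\dots,A_k$ and utility functions $u_i : A_1\times\dots\times A_k \to [-1,1]$, $1\le i\le k$. The players move cyclically in the order $1,2,\dots,k,1,2,\dots$, one player per round, for infinitely many rounds. In each round after the first $k$, player $i$ receives $u_i(a)$, where $a=(a_1,\dots,a_k)$ is the vector of the most recent actions of all players (including the current one); in the first $k$ rounds all players receive $0$. A (mixed) strategy for player $i$ assigns to every finite history of actions after which it is player $i$'s turn a probability distribution on $A_i$; it is pure if all these distributions are degenerate. For a profile $\sigma=(\sigma_1,\dots,\sigma_k)$ of strategies let $P_{i,n}(\sigma)$ be the expected average of the utilities received by player $i$ in the first $n$ rounds when all players follow $\sigma$. The utility of player $i$ under $\sigma$ is $\liminf_{n\to\infty} P_{i,n}(\sigma)$, and $\sigma$ induces the vector of these utilities. The profile $\sigma$ is an equilibrium if no player can strictly increase his utility by unilaterally deviating to another (mixed) strategy. Proposition. Let $\sigma$ be a profile of mixed strategies that induces a utility vector $(t_1,\dots,t_k)$. Then there exists a profile $\sigma'$ of pure strategies that induces exactly the same utility vector $(t_1,\dots,t_k)$. Moreover, if $\sigma$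 is an equilibrium, then so is $\sigma'$. -/

import Mathlib

namespace AltMove

universe v

/-- A `k`-player alternating move game with action sets `A i`: one utility function per player,
with values in `[-1, 1]`. -/
structure Game {k : ℕ} (A : Fin k → Type v) where
  u : Fin k → (∀ j, A j) → ℝ
  u_mem : ∀ i a, u i a ∈ Set.Icc (-1 : ℝ) 1

/-- The player who moves in round `t`. Rounds are numbered `0, 1, 2, …`, and players
`0, …, k - 1` move cyclically, player `0` first. -/
def mover (k : ℕ) [NeZero k] (t : ℕ) : Fin k :=
  ⟨t % k, Nat.mod_lt t (NeZero.pos k)⟩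

variable {k : ℕ} [NeZero k]

/-- Histories of `t` rounds: the actions played in rounds `0, …, t - 1`, where the action of
round `s` belongs to the action set of the player who moves in round `s`. -/
def History (A : Fin k → Type v) : ℕ → Type v
  | 0 => PUnit
  | t + 1 => History A t × A (mover k t)

/-- There are finitely many histories of `t` rounds. -/
noncomputable instance History.instFintype (A : Fin k → Type v) [∀ i, Fintype (A i)] :
    ∀ t, Fintype (History A t)
  | 0 => inferInstanceAs (Fintype PUnit)
  | t + 1 =>
    letI := History.instFintype A t
    inferInstanceAs (Fintype (History A t × A (mover k t)))

/-- The last action of each player along a history (`none` if the player has not moved yet). -/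
def lastAction {A : Fin k → Type v} : ∀ t : ℕ, History A t → ∀ j : Fin k, Option (A j)
  | 0, _ => fun _ => none
  | t + 1, h => Function.update (lastAction t h.1) (mover k t) (some h.2)

theorem lastAction_isSome_of_lt {A : Fin k → Type v} :
    ∀ (t : ℕ) (h : History A t) (j : Fin k), (j : ℕ) < t → (lastAction t h j).isSome := by
  intro t
  induction t with
  | zero => intro h j hj; exact absurd hj (Nat.not_lt_zero _)
  | succ t ih =>
    intro h j hj
    by_cases hm : j = mover k t
    · subst hm
      simp [lastAction]
    · have hlt : (j : ℕ) < t := by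
        rcases Nat.lt_succ_iff_lt_or_eq.mp hj with hl | he
        · exact hl
        · exfalso
          apply hm
          apply Fin.ext
          have hk := j.isLt
          simp only [mover]
          rw [← he, Nat.mod_eq_of_lt hk]
      simpa [lastAction, Function.update_of_ne hm] using ih h.1 j hlt

/-- Once `k` rounds have been played, every player has moved. -/
theorem lastAction_isSome {A : Fin k → Type v} {t : ℕ} (ht : k ≤ t) (h : History A t)
    (j : Fin k) : (lastAction t h j).isSome :=
  lastAction_isSome_of_lt t h j (lt_of_lt_of_le j.isLt ht)

/-- The action vector at the end of a history of at least `k` rounds: the last action of each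
player. -/
def actionVector {A : Fin k → Type v} {t : ℕ} (ht : k ≤ t) (h : History A t) : ∀ j, A j :=
  fun j => (lastAction t h j).get (lastAction_isSome ht h j)

/-- The utility that player `i` receives in the last round of a history of `t` rounds. It is
zero in the first `k` rounds. -/
noncomputable def roundUtility {A : Fin k → Type v} (G : Game A) (i : Fin k) (t : ℕ)
    (h : History A t) : ℝ :=
  if ht : k < t then G.u i (actionVector ht.le h) else 0

/-- The sum of the utilities that player `i` receives in all the rounds of a history. -/
noncomputable def totalUtility {A : Fin k → Type v} (G : Game A) (i : Fin k) :
    ∀ t : ℕ, History A t → ℝ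
  | 0, _ => 0
  | t + 1, h => totalUtility G i t h.1 + roundUtility G i (t + 1) h

/-- A (mixed) strategy of player `i`: a probability distribution over the actions of player `i`
for every finite history after which it is the turn of player `i`. -/
def Strategy (A : Fin k → Type v) (i : Fin k) : Type v :=
  ∀ t : ℕ, mover k t = i → History A t → PMF (A i)

/-- A pure strategy: all the distributions are degenerate. -/
def Strategy.IsPure {A : Fin k → Type v} {i : Fin k} (s : Strategy A i) : Prop :=
  ∀ (t : ℕ) (ht : mover k t = i) (h : History A t), ∃ a : A i, s t ht h = PMF.pure a

/-- A strategy profile: a strategy for every player. -/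
abbrev Profile (A : Fin k → Type v) : Type v :=
  ∀ i, Strategy A i

/-- The distribution of the history of the first `t` rounds under a strategy profile. -/
noncomputable def playDist {A : Fin k → Type v} (σ : Profile A) : ∀ t : ℕ, PMF (History A t)
  | 0 => PMF.pure PUnit.unit
  | t + 1 => (playDist σ t).bind fun h => (σ (mover k t) t rfl h).map fun a => (h, a)

/-- The expected average payoff of player `i` in the first `t` rounds. -/
noncomputable def avgPayoff {A : Fin k → Type v} [∀ i, Fintype (A i)] (G : Game A)
    (σ : Profile A) (i : Fin k) (t : ℕ) : ℝ :=
  ∑ h : History A t, (playDist σ t h).toReal * (totalUtility G i t h / t)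

/-- The utility vector induced by a strategy profile. (The averages lie in `[-1, 1]`, so the
`liminf` in `ℝ` is the genuine one.) -/
noncomputable def utility {A : Fin k → Type v} [∀ i, Fintype (A i)] (G : Game A)
    (σ : Profile A) : Fin k → ℝ :=
  fun i => Filter.liminf (fun t => avgPayoff G σ i t) Filter.atTop

/-- A profile is an equilibrium if no player can strictly improve his utility by unilaterally
deviating to another (mixed) strategy. -/
def IsEquilibrium {A : Fin k → Type v} [∀ i, Fintype (A i)] (G : Game A)
    (σ : Profile A) : Prop :=
  ∀ (i : Fin k) (τ : Strategy A i), utility G (Function.update σ i τ) i ≤ utility G σ i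

end AltMove

/-! Under `σ` the expected payoff vector of a round (up to the bounded error from the first `k`
rounds) lies in the convex hull of the payoff vectors of the finitely many action vectors. A
sequence in this hull can be tracked in Cesàro mean by pure action vectors: one vector is held
throughout each block `[s², (s+1)²)` and chosen against the error accumulated so far, which leaves
an error of order `s^(3/2)` after `s²` rounds (`exists_block_approximation`). Players who cyclically
play these vectors realise them outside a set of rounds of density zero near the block starts. Hence
one deterministic path has the same average payoffs as `σ` up to `o(1)`, and so the same liminf
(`exists_path_approximation`).

For the equilibrium claim, the path is enforced by punishing the first deviator. The zero-sum game
of player `i` against the others has perfect information, and the others can steer to any action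
vector of theirs in boundedly many moves. Letting the discount factor tend to 1 therefore gives a
bounded `φ` and a constant `c` with `shapley G i φ = φ + c` (`exists_optimality_equation`), with
pure positional optimal moves on both sides. Player `i` secures `c` against any profile
(`exists_deviation`), so an equilibrium pays him at least `c`. The punishers hold him to `c`, so a
deviation from the path yields at most a mixture of the path's utility and `c`
(`utility_update_triggerProfile_le`). -/

set_option linter.unusedSectionVars false

open Filter Topology

/-! ### Cesàro approximation by block-constant sequences. -/

/-- Greedy block approximation: a sequence of averages of finitely many points is approximated in
the Cesàro sense by a sequence of points which is constant on the blocks `[s², (s+1)²)`. -/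
theorem exists_block_approximation {ι V : Type*} [Fintype ι] [Finite V] [Nonempty V]
    (u : ι → V → ℝ) (hu : ∀ i a, |u i a| ≤ 1) (x : ℕ → ι → ℝ) (hx : ∀ t i, |x t i| ≤ 1)
    (hconv : ∀ t (D : ι → ℝ), ∃ a, ∑ i, D i * x t i ≤ ∑ i, D i * u i a) :
    ∃ b : ℕ → V, ∀ i, Tendsto
      (fun n : ℕ => (∑ t ∈ Finset.range n, (x t i - u i (b (Nat.sqrt t)))) / n) atTop (𝓝 0) := by
  classical
  choose best hbest using fun D : ι → ℝ => Finite.exists_max fun a => ∑ i, D i * u i a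
  -- `D s` is the error accumulated before time `s²`. Block `s` uses the point maximising the inner
  -- product with `D s`.
  let D : ℕ → ι → ℝ := fun s => Nat.rec (fun _ => 0)
    (fun s Ds i => Ds i + ∑ t ∈ Finset.Ico (s ^ 2) ((s + 1) ^ 2), (x t i - u i (best Ds))) s
  have D_succ : ∀ s i, D (s + 1) i =
      D s i + ∑ t ∈ Finset.Ico (s ^ 2) ((s + 1) ^ 2), (x t i - u i (best (D s))) :=
    fun s i => rfl
  have hterm : ∀ t i a, |x t i - u i a| ≤ 2 := fun t i a => by
    have := abs_sub (x t i) (u i a)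
    linarith [hx t i, hu i a]
  have D_eq : ∀ s i, D s i =
      ∑ t ∈ Finset.range (s ^ 2), (x t i - u i (best (D (Nat.sqrt t)))) := by
    intro s i
    induction s with
    | zero => simp [D]
    | succ s ih =>
      rw [D_succ, ih, Finset.range_eq_Ico, Finset.range_eq_Ico,
        ← Finset.sum_Ico_consecutive _ (Nat.zero_le (s ^ 2))
          (Nat.pow_le_pow_left (Nat.le_succ s) 2)]
      congr 1
      refine Finset.sum_congr rfl fun t ht => ?_
      have : Nat.sqrt t = s := by
        rw [Finset.mem_Ico] at ht
        rw [eq_comm, Nat.eq_sqrt']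
        exact ht
      rw [this]
  have card_Ico : ∀ s : ℕ, ((Finset.Ico (s ^ 2) ((s + 1) ^ 2)).card : ℝ) = 2 * s + 1 := by
    intro s
    rw [Nat.card_Ico, show (s + 1) ^ 2 - s ^ 2 = 2 * s + 1 by
      rw [Nat.sub_eq_iff_eq_add (Nat.pow_le_pow_left (Nat.le_succ s) 2), Nat.succ_eq_add_one]; ring]
    push_cast
    ring
  set K : ℝ := (Fintype.card ι : ℝ) with hK
  -- The cross term in `‖D s + y‖²` is nonpositive by the choice of `best`, so only `‖y‖² ≤
  -- 4K(2s+1)²` is added, and `4(2s+1)² ≤ 16((s+1)³ - s³)`.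
  have D_sq : ∀ s : ℕ, ∑ i, D s i ^ 2 ≤ 16 * K * s ^ 3 := by
    intro s
    induction s with
    | zero => simp [D]
    | succ s ih =>
      set y : ι → ℝ := fun i =>
        ∑ t ∈ Finset.Ico (s ^ 2) ((s + 1) ^ 2), (x t i - u i (best (D s))) with hy
      have h1 : ∑ i, D s i * y i ≤ 0 := by
        have : ∑ i, D s i * y i = ∑ t ∈ Finset.Ico (s ^ 2) ((s + 1) ^ 2),
            (∑ i, D s i * x t i - ∑ i, D s i * u i (best (D s))) := by
          simp only [hy, Finset.mul_sum]
          rw [Finset.sum_comm]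
          refine Finset.sum_congr rfl fun t _ => ?_
          rw [← Finset.sum_sub_distrib]
          exact Finset.sum_congr rfl fun i _ => by ring
        rw [this]
        refine Finset.sum_nonpos fun t _ => ?_
        obtain ⟨a, ha⟩ := hconv t (D s)
        linarith [hbest (D s) a]
      have h2 : ∀ i, y i ^ 2 ≤ (2 * (2 * s + 1)) ^ 2 := by
        intro i
        refine sq_le_sq' ?_ ?_ <;>
        · have := (Finset.abs_sum_le_sum_abs _ _).trans
            (Finset.sum_le_card_nsmul (Finset.Ico (s ^ 2) ((s + 1) ^ 2)) _ 2
              fun t _ => hterm t i (best (D s)))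
          rw [nsmul_eq_mul, card_Ico] at this
          have := abs_le.mp this
          linarith
      have h3 : ∑ i, D (s + 1) i ^ 2 =
          ∑ i, D s i ^ 2 + 2 * ∑ i, D s i * y i + ∑ i, y i ^ 2 := by
        rw [Finset.mul_sum, ← Finset.sum_add_distrib, ← Finset.sum_add_distrib]
        refine Finset.sum_congr rfl fun i _ => ?_
        rw [D_succ]
        ring
      have h4 : ∑ i, y i ^ 2 ≤ K * (2 * (2 * s + 1)) ^ 2 := by
        refine (Finset.sum_le_card_nsmul _ _ _ fun i _ => h2 i).trans ?_
        rw [nsmul_eq_mul, Finset.card_univ]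
      have h5 : 0 ≤ K * (s : ℝ) ^ 2 := by positivity
      have h6 : 0 ≤ K * (s : ℝ) := by positivity
      have h7 : 0 ≤ K := by positivity
      rw [h3]
      push_cast
      nlinarith
  refine ⟨fun s => best (D s), fun i => ?_⟩
  have hsqrt : Tendsto (fun n : ℕ => ((Nat.sqrt n : ℕ) : ℝ)) atTop atTop := by
    refine tendsto_natCast_atTop_atTop.comp (tendsto_atTop.mpr fun m => ?_)
    filter_upwards [eventually_ge_atTop (m ^ 2)] with n hn
    rwa [Nat.le_sqrt']
  have hlim : Tendsto (fun n : ℕ => Real.sqrt (16 * K * ((Nat.sqrt n : ℕ) : ℝ)⁻¹)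
      + 4 * ((Nat.sqrt n : ℕ) : ℝ)⁻¹) atTop (𝓝 0) := by
    have h0 := tendsto_inv_atTop_zero.comp hsqrt
    have h1 := (Real.continuous_sqrt.tendsto _).comp (h0.const_mul (16 * K))
    simpa using h1.add (h0.const_mul 4)
  refine squeeze_zero_norm' ?_ hlim
  filter_upwards [eventually_ge_atTop 1] with n hn
  set s := Nat.sqrt n with hs
  have hs1 : 1 ≤ s := by rw [hs, Nat.le_sqrt']; simpa using hn
  have hs0 : (0 : ℝ) < s := by exact_mod_cast hs1
  have hsn : s ^ 2 ≤ n := Nat.sqrt_le' n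
  have hsn' : n ≤ s ^ 2 + 2 * s := by
    have := Nat.sqrt_le_add n
    rw [← hs] at this
    nlinarith
  have hsnR : (s : ℝ) ^ 2 ≤ n := by exact_mod_cast hsn
  have hD : |D s i| ≤ Real.sqrt (16 * K * s ^ 3) := by
    refine Real.abs_le_sqrt (le_trans ?_ (D_sq s))
    exact Finset.single_le_sum (f := fun i => D s i ^ 2) (fun i _ => sq_nonneg _)
      (Finset.mem_univ i)
  -- The unfinished last block has at most `2s` rounds, each with error at most 2.
  have hrest : |∑ t ∈ Finset.Ico (s ^ 2) n, (x t i - u i (best (D (Nat.sqrt t))))| ≤ 4 * s := by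
    refine ((Finset.abs_sum_le_sum_abs _ _).trans
      (Finset.sum_le_card_nsmul _ _ 2 fun t _ => hterm t i _)).trans ?_
    rw [nsmul_eq_mul, Nat.card_Ico]
    have : ((n - s ^ 2 : ℕ) : ℝ) ≤ 2 * s := by
      exact_mod_cast (Nat.sub_le_iff_le_add'.mpr hsn')
    linarith
  have htot : |∑ t ∈ Finset.range n, (x t i - u i (best (D (Nat.sqrt t))))| ≤
      Real.sqrt (16 * K * s ^ 3) + 4 * s := by
    rw [Finset.range_eq_Ico, ← Finset.sum_Ico_consecutive _ (Nat.zero_le (s ^ 2)) hsn,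
      ← Finset.range_eq_Ico, ← D_eq]
    exact (abs_add_le _ _).trans (add_le_add hD hrest)
  rw [Real.norm_eq_abs, abs_div, Nat.abs_cast]
  have e1 : Real.sqrt (16 * K * s ^ 3) = Real.sqrt (16 * K * (s : ℝ)⁻¹) * s ^ 2 := by
    conv_rhs => rw [← Real.sqrt_sq (by positivity : (0 : ℝ) ≤ (s : ℝ) ^ 2)]
    rw [← Real.sqrt_mul (by positivity)]
    congr 1
    field_simp
  have hnpos : (0 : ℝ) < n := lt_of_lt_of_le (by positivity) hsnR
  rw [div_le_iff₀ hnpos]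
  refine htot.trans ?_
  have e2 : Real.sqrt (16 * K * s ^ 3) + 4 * s =
      (Real.sqrt (16 * K * (s : ℝ)⁻¹) + 4 * (s : ℝ)⁻¹) * s ^ 2 := by
    rw [e1]; field_simp
  rw [e2]
  exact mul_le_mul_of_nonneg_left hsnR (by positivity)

/-- The set of times at distance less than `k` after the beginning of a block `[s², (s+1)²)` has
density zero. -/
theorem tendsto_card_sqrt_ne_div (k : ℕ) :
    Tendsto (fun n : ℕ => (((Finset.range n).filter
      fun t => t < k ∨ Nat.sqrt (t - k) ≠ Nat.sqrt t).card : ℝ) / n) atTop (𝓝 0) := by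
  have hsqrt : Tendsto (fun n : ℕ => ((Nat.sqrt n : ℕ) : ℝ)) atTop atTop := by
    refine tendsto_natCast_atTop_atTop.comp (tendsto_atTop.mpr fun m => ?_)
    filter_upwards [eventually_ge_atTop (m ^ 2)] with n hn
    rwa [Nat.le_sqrt']
  have hcard : ∀ n, ((Finset.range n).filter fun t => t < k ∨ Nat.sqrt (t - k) ≠ Nat.sqrt t).card ≤
      (Nat.sqrt n + 1) * k := by
    intro n
    rw [← Finset.card_range (Nat.sqrt n + 1), ← Finset.card_range k, ← Finset.card_product,
      Finset.card_range k]
    -- A time is determined by its block and its offset there; an offset of at least `k` would put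
    -- `t - k` in the same block.
    refine Finset.card_le_card_of_injOn (fun t => (Nat.sqrt t, t - Nat.sqrt t ^ 2)) ?_ ?_
    · intro t ht
      simp only [Finset.coe_filter, Finset.mem_range, Set.mem_ofPred_eq] at ht
      simp only [Finset.coe_product, Finset.coe_range, Set.mem_prod, Set.mem_Iio]
      refine ⟨Nat.lt_succ_of_le (Nat.sqrt_le_sqrt ht.1.le), ?_⟩
      by_contra hcon
      refine ht.2.elim (fun h => by omega) fun h => h ?_
      refine le_antisymm (Nat.sqrt_le_sqrt (Nat.sub_le _ _)) ?_
      rw [Nat.le_sqrt']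
      have := Nat.sqrt_le' t
      omega
    · intro t _ t' _ h
      simp only [Prod.mk.injEq] at h
      have h1 := Nat.sqrt_le' t
      have h2 := Nat.sqrt_le' t'
      have h3 := h.2
      rw [h.1] at h1 h3
      omega
  have hlim : Tendsto (fun n : ℕ => 2 * (k : ℝ) * ((Nat.sqrt n : ℕ) : ℝ)⁻¹) atTop (𝓝 0) := by
    simpa using (tendsto_inv_atTop_zero.comp hsqrt).const_mul (2 * (k : ℝ))
  refine squeeze_zero' (Eventually.of_forall fun n => by positivity) ?_ hlim
  filter_upwards [eventually_ge_atTop 1] with n hn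
  have hs1 : 1 ≤ Nat.sqrt n := by rw [Nat.le_sqrt']; simpa using hn
  have hsR : (1 : ℝ) ≤ Nat.sqrt n := by exact_mod_cast hs1
  have hsn : ((Nat.sqrt n : ℕ) : ℝ) ^ 2 ≤ n := by exact_mod_cast Nat.sqrt_le' n
  have hc : (((Finset.range n).filter fun t => t < k ∨ Nat.sqrt (t - k) ≠ Nat.sqrt t).card : ℝ) ≤
      (Nat.sqrt n + 1) * k := by exact_mod_cast hcard n
  rw [div_le_iff₀ (by positivity)]
  calc _ ≤ ((Nat.sqrt n : ℝ) + 1) * k := hc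
    _ ≤ 2 * k * (Nat.sqrt n : ℝ) := by nlinarith [Nat.cast_nonneg (α := ℝ) k]
    _ = 2 * k * (Nat.sqrt n : ℝ)⁻¹ * (Nat.sqrt n : ℝ) ^ 2 := by field_simp
    _ ≤ _ := mul_le_mul_of_nonneg_left hsn (by positivity)

/-! ### Expectations along the play. -/

namespace AltMove
universe v
variable {k : ℕ} [NeZero k] {A : Fin k → Type v} [∀ i, Fintype (A i)]

theorem mover_succ (t : ℕ) : mover k (t + 1) = mover k t + 1 := by
  apply Fin.ext
  simp [mover, Fin.val_add, Nat.add_mod]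

theorem mover_val (p : Fin k) : mover k p.val = p := Fin.ext (Nat.mod_eq_of_lt p.isLt)

theorem mover_add_mul (t m : ℕ) : mover k (t + k * m) = mover k t :=
  Fin.ext (Nat.add_mul_mod_self_left t k m)

/-- A distribution has nonempty support, so the mere existence of a profile supplies histories and
actions. -/
theorem nonempty_of_profile (σ : Profile A) (i : Fin k) : Nonempty (A i) := by
  have hH : ∀ t, Nonempty (History A t) := fun t =>
    ⟨(playDist σ t).support_nonempty.some⟩
  obtain ⟨h⟩ := hH i.val
  exact ⟨((σ i i.val (mover_val i) h).support_nonempty).some⟩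

/-- The expectation of a function of the history of the first `t` rounds. -/
noncomputable def expect (σ : Profile A) (t : ℕ) (f : History A t → ℝ) : ℝ :=
  ∑ h : History A t, (playDist σ t h).toReal * f h

theorem playDist_succ_apply (σ : Profile A) (t : ℕ) (h : History A t) (a : A (mover k t)) :
    playDist σ (t + 1) (h, a) = playDist σ t h * σ (mover k t) t rfl h a := by
  classical
  change ((playDist σ t).bind fun h => (σ (mover k t) t rfl h).map fun a => (h, a)) (h, a) = _
  rw [PMF.bind_apply, tsum_eq_single h]
  · congr 1
    rw [PMF.map_apply, tsum_eq_single a]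
    · simp
    · intro b hb
      rw [if_neg]
      intro e
      exact hb (Prod.ext_iff.mp e).2.symm
  · intro h' hh
    convert mul_zero _
    rw [PMF.map_apply, ENNReal.tsum_eq_zero]
    intro b
    rw [if_neg]
    intro e
    exact hh (Prod.ext_iff.mp e).1.symm

theorem expect_succ (σ : Profile A) (t : ℕ) (f : History A (t + 1) → ℝ) :
    expect σ (t + 1) f =
      expect σ t fun h => ∑ a, (σ (mover k t) t rfl h a).toReal * f (h, a) := by
  have : expect σ (t + 1) f = ∑ h : History A t × A (mover k t),
      (playDist σ (t + 1) h).toReal * f h := rfl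
  rw [this, Fintype.sum_prod_type]
  refine Finset.sum_congr rfl fun h _ => ?_
  rw [Finset.mul_sum]
  refine Finset.sum_congr rfl fun a _ => ?_
  rw [playDist_succ_apply, ENNReal.toReal_mul, mul_assoc]

theorem sum_toReal_pmf {α : Type*} [Fintype α] (p : PMF α) : ∑ a, (p a).toReal = 1 := by
  rw [← ENNReal.toReal_sum fun a _ => p.apply_ne_top a, ← tsum_fintype (L := .unconditional α), p.tsum_coe,
    ENNReal.toReal_one]

theorem expect_const (σ : Profile A) (t : ℕ) (c : ℝ) : expect σ t (fun _ => c) = c := by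
  rw [expect, ← Finset.sum_mul, sum_toReal_pmf, one_mul]

theorem expect_add (σ : Profile A) (t : ℕ) (f g : History A t → ℝ) :
    expect σ t (fun h => f h + g h) = expect σ t f + expect σ t g := by
  simp only [expect, mul_add, Finset.sum_add_distrib]

theorem expect_mul (σ : Profile A) (t : ℕ) (c : ℝ) (f : History A t → ℝ) :
    expect σ t (fun h => c * f h) = c * expect σ t f := by
  simp only [expect, Finset.mul_sum]
  exact Finset.sum_congr rfl fun h _ => by ring

theorem expect_sum {ι : Type*} (s : Finset ι) (σ : Profile A) (t : ℕ)
    (f : ι → History A t → ℝ) :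
    expect σ t (fun h => ∑ i ∈ s, f i h) = ∑ i ∈ s, expect σ t (f i) := by
  simp only [expect, Finset.mul_sum]
  exact Finset.sum_comm

theorem expect_mono (σ : Profile A) (t : ℕ) {f g : History A t → ℝ}
    (H : ∀ h ∈ (playDist σ t).support, f h ≤ g h) : expect σ t f ≤ expect σ t g := by
  refine Finset.sum_le_sum fun h _ => ?_
  by_cases hh : playDist σ t h = 0
  · simp [hh]
  · exact mul_le_mul_of_nonneg_left (H h ((PMF.mem_support_iff _ _).mpr hh))
      ENNReal.toReal_nonneg

/-- The one-step supermartingale inequality behind the potential arguments; it is needed only for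
histories and actions of positive probability. -/
theorem expect_succ_le (σ : Profile A) (t : ℕ) {f : History A (t + 1) → ℝ}
    {g : History A t → ℝ}
    (H : ∀ h ∈ (playDist σ t).support, ∀ a ∈ (σ (mover k t) t rfl h).support,
      f (h, a) ≤ g h) : expect σ (t + 1) f ≤ expect σ t g := by
  rw [expect_succ]
  refine expect_mono σ t fun h hh => ?_
  rw [← one_mul (g h), ← sum_toReal_pmf (σ (mover k t) t rfl h), Finset.sum_mul]
  refine Finset.sum_le_sum fun a _ => ?_
  by_cases ha : σ (mover k t) t rfl h a = 0
  · simp [ha]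
  · exact mul_le_mul_of_nonneg_left (H h hh a ((PMF.mem_support_iff _ _).mpr ha))
      ENNReal.toReal_nonneg

theorem expect_succ_fst (σ : Profile A) (t : ℕ) (f : History A t → ℝ) :
    expect σ (t + 1) (fun h => f h.1) = expect σ t f := by
  rw [expect_succ]
  simp only [← Finset.sum_mul, sum_toReal_pmf, one_mul]

theorem mem_support_succ (σ : Profile A) (t : ℕ) (h : History A t) (a : A (mover k t))
    (H : (h, a) ∈ (playDist σ (t + 1)).support) :
    h ∈ (playDist σ t).support ∧ a ∈ (σ (mover k t) t rfl h).support := by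
  have H : playDist σ (t + 1) (h, a) ≠ 0 := H
  rw [playDist_succ_apply] at H
  exact ⟨(PMF.mem_support_iff _ _).mpr (left_ne_zero_of_mul H),
    (PMF.mem_support_iff _ _).mpr (right_ne_zero_of_mul H)⟩

/-! ### Payoffs without the exceptional first `k` rounds. -/

section Ideal
variable [∀ i, Nonempty (A i)]

/-- The vector of last actions along a history; players who have not moved yet are given an
arbitrary action. -/
noncomputable def vec {A : Fin k → Type v} [∀ i, Nonempty (A i)] (t : ℕ) (h : History A t) :
    ∀ j, A j :=
  fun j => (lastAction t h j).getD (Classical.arbitrary _)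

theorem vec_succ (t : ℕ) (h : History A t) (a : A (mover k t)) :
    vec (A := A) (t + 1) (h, a) = Function.update (vec t h) (mover k t) a := by
  funext j
  by_cases hj : j = mover k t
  · subst hj
    simp [vec, lastAction]
  · simp [vec, lastAction, Function.update_of_ne hj]

/-- The sum of the utilities of player `i` along a history if utilities were also received in the
first `k` rounds, as given by `vec`. -/
noncomputable def idealTotal {A : Fin k → Type v} [∀ i, Nonempty (A i)] (G : Game A)
    (i : Fin k) : ∀ t, History A t → ℝ
  | 0, _ => 0
  | t + 1, h => idealTotal G i t h.1 + G.u i (vec (t + 1) h)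

theorem abs_u_le (G : Game A) (i : Fin k) (a : ∀ j, A j) : |G.u i a| ≤ 1 :=
  abs_le.mpr (G.u_mem i a)

theorem abs_idealTotal_le (G : Game A) (i : Fin k) :
    ∀ (t : ℕ) (h : History A t), |idealTotal G i t h| ≤ t := by
  intro t
  induction t with
  | zero => intro h; simp [idealTotal]
  | succ t ih =>
    intro h
    rw [idealTotal]
    push_cast
    exact (abs_add_le _ _).trans (add_le_add (ih h.1) (abs_u_le G i _))

theorem roundUtility_of_lt (G : Game A) (i : Fin k) {t : ℕ} (ht : k < t) (h : History A t) :
    roundUtility G i t h = G.u i (vec t h) := by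
  rw [roundUtility, dif_pos ht]
  congr 1
  funext j
  rw [actionVector, vec, Option.get_eq_getD]

/-- Only the first `k` rounds differ, each by at most 1, so the long-run averages agree. -/
theorem abs_totalUtility_sub_idealTotal_le (G : Game A) (i : Fin k) :
    ∀ (t : ℕ) (h : History A t), |totalUtility G i t h - idealTotal G i t h| ≤ min (t : ℝ) k := by
  intro t
  induction t with
  | zero => intro h; simp [idealTotal, totalUtility]
  | succ t ih =>
    intro h
    rw [idealTotal, totalUtility]
    by_cases ht : k < t + 1
    · rw [roundUtility_of_lt G i ht, add_sub_add_right_eq_sub]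
      refine (ih h.1).trans ?_
      push_cast
      exact min_le_min_right _ (by linarith)
    · rw [roundUtility, dif_neg ht]
      have h1 := ih h.1
      have h2 := abs_u_le G i (vec (t + 1) h)
      have h3 : ((t + 1 : ℕ) : ℝ) ≤ k := by exact_mod_cast not_lt.mp ht
      rw [min_eq_left h3]
      rw [min_eq_left (by push_cast at h3; linarith)] at h1
      push_cast
      rw [abs_le] at *
      constructor <;> linarith

theorem expect_idealTotal (G : Game A) (σ : Profile A) (i : Fin k) (n : ℕ) :
    expect σ n (idealTotal G i n) =
      ∑ t ∈ Finset.range n, expect σ (t + 1) fun h => G.u i (vec (t + 1) h) := by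
  induction n with
  | zero => simpa [idealTotal] using expect_const σ 0 0
  | succ n ih =>
    rw [Finset.sum_range_succ, ← ih, ← expect_succ_fst σ n, ← expect_add]
    rfl

theorem abs_expect_le (σ : Profile A) (t : ℕ) {f : History A t → ℝ} {c : ℝ}
    (H : ∀ h, |f h| ≤ c) : |expect σ t f| ≤ c := by
  rw [abs_le]
  constructor
  · rw [← expect_const σ t (-c)]
    exact expect_mono σ t fun h _ => (abs_le.mp (H h)).1
  · conv_rhs => rw [← expect_const σ t c]
    exact expect_mono σ t fun h _ => (abs_le.mp (H h)).2

theorem abs_avgPayoff_sub_le (G : Game A) (σ : Profile A) (i : Fin k) (n : ℕ) :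
    |avgPayoff G σ i n - expect σ n (idealTotal G i n) / n| ≤ (k : ℝ) / n := by
  have h1 : avgPayoff G σ i n - expect σ n (idealTotal G i n) / n =
      expect σ n (fun h => totalUtility G i n h + (-1) * idealTotal G i n h) / n := by
    have h2 : avgPayoff G σ i n = expect σ n (totalUtility G i n) / n := by
      rw [avgPayoff, expect, Finset.sum_div]
      simp only [mul_div_assoc]
    rw [expect_add, expect_mul, h2]
    ring
  rw [h1, abs_div, Nat.abs_cast]
  refine div_le_div_of_nonneg_right (abs_expect_le σ n fun h => ?_) (Nat.cast_nonneg n)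
  rw [neg_one_mul, ← sub_eq_add_neg]
  exact (abs_totalUtility_sub_idealTotal_le G i n h).trans (min_le_right _ _)

theorem tendsto_avgPayoff_sub (G : Game A) (σ : Profile A) (i : Fin k) :
    Tendsto (fun n : ℕ => avgPayoff G σ i n - expect σ n (idealTotal G i n) / n) atTop (𝓝 0) :=
  squeeze_zero_norm (fun n => abs_avgPayoff_sub_le G σ i n)
    (tendsto_const_div_atTop_nhds_zero_nat (k : ℝ))

theorem abs_expect_idealTotal_div_le (G : Game A) (σ : Profile A) (i : Fin k) (n : ℕ) :
    |expect σ n (idealTotal G i n) / n| ≤ 1 := by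
  rw [abs_div, Nat.abs_cast]
  exact div_le_one_of_le₀ (abs_expect_le σ n (abs_idealTotal_le G i n)) (Nat.cast_nonneg n)

end Ideal

theorem isBoundedUnder_of_abs_le {f : ℕ → ℝ} {c : ℝ} (H : ∀ n, |f n| ≤ c) :
    IsBoundedUnder (· ≤ ·) atTop f ∧ IsBoundedUnder (· ≥ ·) atTop f :=
  ⟨isBoundedUnder_of ⟨c, fun n => (abs_le.mp (H n)).2⟩,
    isBoundedUnder_of ⟨-c, fun n => (abs_le.mp (H n)).1⟩⟩

/-- Averages need not converge, so utilities are compared through one-sided bounds with vanishing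
error. -/
theorem liminf_le_liminf_of_le_add {f g e : ℕ → ℝ} {c d : ℝ} (hf : ∀ n, |f n| ≤ c)
    (hg : ∀ n, |g n| ≤ d) (he : Tendsto e atTop (𝓝 0)) (H : ∀ᶠ n in atTop, f n ≤ g n + e n) :
    liminf f atTop ≤ liminf g atTop := by
  obtain ⟨hf1, hf2⟩ := isBoundedUnder_of_abs_le hf
  obtain ⟨hg1, hg2⟩ := isBoundedUnder_of_abs_le hg
  refine le_of_forall_pos_le_add fun ε hε => ?_
  rw [← sub_le_iff_le_add]
  refine le_of_forall_lt fun x hx => ?_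
  have h1 : x + ε < liminf f atTop := by linarith
  obtain ⟨y, hy1, hy2⟩ := exists_between h1
  have h2 : ∀ᶠ n in atTop, y - ε ≤ g n := by
    filter_upwards [eventually_lt_of_lt_liminf hy2 hf2, H, he.eventually (gt_mem_nhds hε)]
      with n a b c
    linarith
  have h3 : y - ε ≤ liminf g atTop := le_liminf_of_le hg1.isCoboundedUnder_ge h2
  linarith

end AltMove

/-! ### The zero-sum game of one player against the rest. -/

namespace AltMove
universe v
variable {k : ℕ} [NeZero k] {A : Fin k → Type v} [∀ i, Fintype (A i)]

section Potential
variable [∀ i, Nonempty (A i)]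

/-- Positions of the game: the player to move and the last actions of all players. -/
abbrev Position (A : Fin k → Type v) : Type v := Fin k × (∀ j, A j)

/-- The value for player `i` of playing `x` at the position `s`, when the continuation is valued
by `φ`. -/
noncomputable def moveValue (G : Game A) (i : Fin k) (φ : Position A → ℝ) (p : Fin k)
    (a : ∀ j, A j) (x : A p) : ℝ :=
  G.u i (Function.update a p x) + φ (p + 1, Function.update a p x)

/-- The one-step operator of the zero-sum game of player `i` against all other players. -/
noncomputable def shapley (G : Game A) (i : Fin k) (φ : Position A → ℝ) (s : Position A) : ℝ :=
  if s.1 = i then ⨆ x, moveValue G i φ s.1 s.2 x else ⨅ x, moveValue G i φ s.1 s.2 x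

theorem le_shapley (G : Game A) {i : Fin k} (φ : Position A → ℝ) (a : ∀ j, A j) (x : A i) :
    moveValue G i φ i a x ≤ shapley G i φ (i, a) := by
  rw [shapley, if_pos rfl]
  exact le_ciSup (f := moveValue G i φ i a) (Set.finite_range _).bddAbove x

theorem shapley_le (G : Game A) {i p : Fin k} (hp : p ≠ i) (φ : Position A → ℝ) (a : ∀ j, A j)
    (x : A p) : shapley G i φ (p, a) ≤ moveValue G i φ p a x := by
  rw [shapley, if_neg hp]
  exact ciInf_le (f := moveValue G i φ p a) (Set.finite_range _).bddBelow x

theorem exists_eq_shapley (G : Game A) (i p : Fin k) (φ : Position A → ℝ) (a : ∀ j, A j) :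
    ∃ x : A p, moveValue G i φ p a x = shapley G i φ (p, a) := by
  by_cases hp : p = i
  · rw [shapley, if_pos hp]
    exact exists_eq_ciSup_of_finite
  · rw [shapley, if_neg hp]
    exact exists_eq_ciInf_of_finite

theorem shapley_le_add (G : Game A) (i : Fin k) {φ ψ : Position A → ℝ} {c : ℝ}
    (H : ∀ s, φ s ≤ ψ s + c) (s : Position A) : shapley G i φ s ≤ shapley G i ψ s + c := by
  obtain ⟨p, a⟩ := s
  have hm : ∀ x : A p, moveValue G i φ p a x ≤ moveValue G i ψ p a x + c := fun x => by
    have := H (p + 1, Function.update a p x)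
    simp only [moveValue]
    linarith
  by_cases hp : p = i
  · subst hp
    obtain ⟨x, hx⟩ := exists_eq_shapley G p p φ a
    rw [← hx]
    linarith [hm x, le_shapley G ψ a x]
  · obtain ⟨x, hx⟩ := exists_eq_shapley G i p ψ a
    rw [← hx]
    linarith [hm x, shapley_le G hp φ a x]

theorem lipschitzWith_shapley (G : Game A) (i : Fin k) :
    LipschitzWith 1 (shapley G i : (Position A → ℝ) → Position A → ℝ) := by
  refine LipschitzWith.mk_one fun φ ψ => ?_
  have key : ∀ φ ψ : Position A → ℝ, ∀ s, φ s ≤ ψ s + dist φ ψ := fun φ ψ s => by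
    have := (abs_le.mp ((Real.dist_eq _ _).symm.trans_le (dist_le_pi_dist φ ψ s))).2
    linarith
  refine (dist_pi_le_iff dist_nonneg).mpr fun s => ?_
  rw [Real.dist_eq, abs_le]
  have h1 := shapley_le_add G i (key φ ψ) s
  have h2 := shapley_le_add G i (key ψ φ) s
  rw [dist_comm] at h2
  constructor <;> linarith

theorem shapley_add_const (G : Game A) (i : Fin k) (φ : Position A → ℝ) (c : ℝ) :
    shapley G i (fun s => φ s + c) = fun s => shapley G i φ s + c := by
  funext s
  refine le_antisymm (shapley_le_add G i (fun _ => le_rfl) s) ?_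
  have := shapley_le_add G i (φ := φ) (ψ := fun s => φ s + c) (c := -c)
    (fun s => by linarith) s
  linarith

theorem abs_shapley_zero_le (G : Game A) (i : Fin k) (s : Position A) :
    |shapley G i 0 s| ≤ 1 := by
  obtain ⟨x, hx⟩ := exists_eq_shapley G i s.1 0 s.2
  rw [← Prod.mk.eta (p := s), ← hx]
  simpa [moveValue] using abs_u_le G i _

/-- For `β < 1` the discounted operator is a `β`-contraction; its fixed point satisfies `‖w‖ ≤ 1 +
β‖w‖`. -/
theorem exists_discounted (G : Game A) (i : Fin k) {β : ℝ} (h0 : 0 ≤ β) (h1 : β < 1) :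
    ∃ w : Position A → ℝ, shapley G i (fun s => β * w s) = w ∧
      ∀ s, (1 - β) * |w s| ≤ 1 := by
  have hlip : LipschitzWith (⟨β, h0⟩ : NNReal) fun w : Position A → ℝ =>
      shapley G i fun s => β * w s := by
    refine LipschitzWith.of_dist_le_mul fun φ ψ => ?_
    refine ((lipschitzWith_shapley G i).dist_le_mul _ _).trans ?_
    rw [NNReal.coe_one, one_mul]
    refine (dist_pi_le_iff (by positivity)).mpr fun s => ?_
    rw [Real.dist_eq, ← mul_sub, abs_mul, abs_of_nonneg h0, ← Real.dist_eq]
    exact mul_le_mul_of_nonneg_left (dist_le_pi_dist φ ψ s) h0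
  have hc : ContractingWith (⟨β, h0⟩ : NNReal) fun w : Position A → ℝ =>
      shapley G i fun s => β * w s := ⟨by exact_mod_cast h1, hlip⟩
  refine ⟨hc.fixedPoint, hc.fixedPoint_isFixedPt, fun s => ?_⟩
  set w := hc.fixedPoint with hw
  have hfix : (shapley G i fun s => β * w s) = w := hc.fixedPoint_isFixedPt
  have hn : ‖w‖ ≤ 1 + β * ‖w‖ := by
    have ha := hlip.dist_le_mul w 0
    have hb : ‖shapley G i (0 : Position A → ℝ)‖ ≤ 1 :=
      (pi_norm_le_iff_of_nonneg zero_le_one).mpr (abs_shapley_zero_le G i)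
    have hz : (fun s : Position A => β * (0 : Position A → ℝ) s) = 0 := by
      funext s
      simp
    simp only [hfix, hz, dist_zero_right] at ha
    have hd := norm_sub_norm_le w (shapley G i (0 : Position A → ℝ))
    rw [← dist_eq_norm] at hd
    have ha : dist w (shapley G i 0) ≤ β * ‖w‖ := ha
    linarith
  have hs : |w s| ≤ ‖w‖ := norm_le_pi_norm w s
  nlinarith

/-- The bound is uniform in `β`, which is what survives the limit `β → 1`. Passing from the value of
a move to `w` at the next position costs at most 2. Optimal play from `s'` reaches some `(i, b)`
within `2k` moves, and from `s` the opponents can steer to `b` within `3k` moves, giving `2 · (2k +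
3k)`. -/
theorem discounted_span (G : Game A) (i : Fin k) {β : ℝ} (h1 : β < 1)
    {w : Position A → ℝ} (hw : shapley G i (fun s => β * w s) = w)
    (hb : ∀ s, (1 - β) * |w s| ≤ 1) (s s' : Position A) : w s ≤ w s' + 10 * k := by
  have hmove : ∀ p (a : ∀ j, A j) (x : A p),
      |moveValue G i (fun s => β * w s) p a x - w (p + 1, Function.update a p x)| ≤ 2 := by
    intro p a x
    have e1 := abs_u_le G i (Function.update a p x)
    have e2 := hb (p + 1, Function.update a p x)
    have e3 : moveValue G i (fun s => β * w s) p a x - w (p + 1, Function.update a p x) =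
        G.u i (Function.update a p x) - (1 - β) * w (p + 1, Function.update a p x) := by
      simp only [moveValue]
      ring
    rw [e3]
    refine (abs_sub _ _).trans ?_
    rw [abs_mul, abs_of_pos (by linarith : 0 < 1 - β)]
    linarith
  -- The opponents of `i` play their coordinates of `b`; those who do not move in the remaining
  -- window must already agree with `b`.
  have upper : ∀ (b : ∀ j, A j) (m t : ℕ) (a : ∀ j, A j), mover k (t + m) = i →
      (∀ j ≠ i, (∀ l, t ≤ l → l < t + m → mover k l ≠ j) → a j = b j) →
      w (mover k t, a) ≤ w (i, b) + 2 * m := by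
    intro b m
    induction m with
    | zero =>
      intro t a ht hab
      have ht : mover k t = i := ht
      -- The last action of `i` is overwritten at his turn, so the opponents need not control it.
      have : ∀ x, Function.update a i x = Function.update b i x := by
        intro x
        funext j
        by_cases hj : j = i
        · subst hj
          simp
        · rw [Function.update_of_ne hj, Function.update_of_ne hj]
          exact hab j hj fun l h1 h2 => by omega
      rw [ht, ← hw]
      simp [shapley, moveValue, this]
    | succ m ih =>
      intro t a ht hab
      have step : ∀ x : A (mover k t), (mover k t ≠ i → x = b (mover k t)) →
          moveValue G i (fun s => β * w s) (mover k t) a x ≤ w (i, b) + 2 * (m + 1 : ℕ) := by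
        intro x hx
        have e1 := (abs_le.mp (hmove (mover k t) a x)).2
        have e2 := ih (t + 1) (Function.update a (mover k t) x)
          (by rw [← ht]; congr 1; omega) ?_
        · rw [mover_succ] at e2
          push_cast
          linarith
        · intro j hj hl
          by_cases hjt : j = mover k t
          · subst hjt
            rw [Function.update_self]
            exact hx hj
          · rw [Function.update_of_ne hjt]
            refine hab j hj fun l h1 h2 => ?_
            rcases h1.eq_or_lt with rfl | h1
            · exact fun h => hjt h.symm
            · exact hl l h1 (by omega)
      by_cases hp : mover k t = i
      · obtain ⟨x, hx⟩ := exists_eq_shapley G i (mover k t) (fun s => β * w s) a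
        rw [hw] at hx
        rw [← hx]
        exact step x fun h => absurd hp h
      · have := shapley_le G hp (fun s => β * w s) a (b (mover k t))
        rw [hw] at this
        exact this.trans (step _ fun _ => rfl)
  have lower : ∀ (m t : ℕ) (a : ∀ j, A j), mover k (t + m) = i →
      ∃ b, w (i, b) ≤ w (mover k t, a) + 2 * m := by
    intro m
    induction m with
    | zero =>
      intro t a ht
      exact ⟨a, by rw [show mover k t = i from ht]; simp⟩
    | succ m ih =>
      intro t a ht
      obtain ⟨x, hx⟩ := exists_eq_shapley G i (mover k t) (fun s => β * w s) a
      obtain ⟨b, hb⟩ := ih (t + 1) (Function.update a (mover k t) x)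
        (by rw [← ht]; congr 1; omega)
      refine ⟨b, ?_⟩
      rw [hw] at hx
      have e1 := (abs_le.mp (hmove (mover k t) a x)).1
      rw [mover_succ] at hb
      push_cast
      linarith
  obtain ⟨p, a⟩ := s
  obtain ⟨p', a'⟩ := s'
  have hi := i.isLt
  have hp := p.isLt
  have hp' := p'.isLt
  obtain ⟨b, hb⟩ := lower (i.val + k - p'.val) p'.val a' (by
    rw [show p'.val + (i.val + k - p'.val) = i.val + k * 1 by omega, mover_add_mul, mover_val])
  -- Arriving at time `i + 2k` ensures that the window contains the turn `j + k` of every opponent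
  -- `j`.
  have hup := upper b (i.val + 2 * k - p.val) p.val a (by
      rw [show p.val + (i.val + 2 * k - p.val) = i.val + k * 2 by omega, mover_add_mul,
        mover_val]) (by
    intro j hj hl
    refine absurd ?_ (hl (j.val + k * 1) ?_ ?_)
    · rw [mover_add_mul, mover_val]
    · omega
    · have := j.isLt
      omega)
  rw [mover_val] at hb hup
  have c1 : ((i.val + k - p'.val : ℕ) : ℝ) ≤ 2 * k := by
    exact_mod_cast (by omega : i.val + k - p'.val ≤ 2 * k)
  have c2 : ((i.val + 2 * k - p.val : ℕ) : ℝ) ≤ 3 * k := by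
    exact_mod_cast (by omega : i.val + 2 * k - p.val ≤ 3 * k)
  linarith

/-- The ergodic optimality equation: the zero-sum game of player `i` against all others has a
value `v` independent of the position, and a bounded relative value function `φ`. -/
theorem exists_optimality_equation (G : Game A) (i : Fin k) :
    ∃ (φ : Position A → ℝ) (c : ℝ), |c| ≤ 1 ∧ shapley G i φ = fun s => φ s + c := by
  have s₀ : Position A := (0, fun j => Classical.arbitrary _)
  let β : ℕ → ℝ := fun n => 1 - 1 / ((n : ℝ) + 1)
  have hpos : ∀ n : ℕ, 0 < 1 / ((n : ℝ) + 1) := fun n => by positivity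
  have hβ1 : ∀ n, β n < 1 := fun n => by
    have := hpos n
    simp only [β]
    linarith
  have hβ0 : ∀ n, 0 ≤ β n := fun n => by
    have : 1 / ((n : ℝ) + 1) ≤ 1 := by
      rw [div_le_one (by positivity)]
      linarith [Nat.cast_nonneg (α := ℝ) n]
    simp only [β]
    linarith
  choose w hw hb using fun n => exists_discounted G i (hβ0 n) (hβ1 n)
  have hspan := fun n => discounted_span G i (hβ1 n) (hw n) (hb n)
  -- Values relative to `s₀` stay bounded by `discounted_span`, and the normalised value at `s₀`
  -- lies in `[-1, 1]`; a limit point of these pairs is `(φ, c)`.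
  let z : ℕ → (Position A → ℝ) × ℝ := fun n =>
    (fun s => w n s - w n s₀, (1 - β n) * w n s₀)
  have hz : ∀ n, z n ∈ (Set.univ.pi fun _ : Position A => Set.Icc (-(10 * k : ℝ)) (10 * k)) ×ˢ
      Set.Icc (-1 : ℝ) 1 := by
    intro n
    refine ⟨fun s _ => ⟨?_, ?_⟩, ?_⟩
    · have := hspan n s₀ s
      simp only [z]
      linarith
    · have := hspan n s s₀
      simp only [z]
      linarith
    · refine abs_le.mp ?_
      rw [abs_mul, abs_of_pos (sub_pos.mpr (hβ1 n))]
      exact hb n s₀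
  have hcomp : IsCompact ((Set.univ.pi fun _ : Position A =>
      Set.Icc (-(10 * k : ℝ)) (10 * k)) ×ˢ Set.Icc (-1 : ℝ) 1) :=
    (isCompact_univ_pi fun _ => isCompact_Icc).prod isCompact_Icc
  obtain ⟨⟨φ, c⟩, hmem, θ, hθ, hlim⟩ := hcomp.tendsto_subseq hz
  refine ⟨φ, c, abs_le.mpr hmem.2, ?_⟩
  have heq : ∀ n, shapley G i (fun s => β n * (z n).1 s) = fun s => (z n).1 s + (z n).2 := by
    intro n
    have e := shapley_add_const G i (fun s => β n * w n s) (-(β n * w n s₀))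
    rw [hw n] at e
    have e2 : (fun s => β n * (z n).1 s) = fun s => β n * w n s + -(β n * w n s₀) := by
      funext s
      simp only [z]
      ring
    rw [e2, e]
    funext s
    simp only [z]
    ring
  have hβ : Tendsto β atTop (𝓝 1) := by
    simpa [β] using (tendsto_const_nhds (x := (1 : ℝ))).sub (tendsto_one_div_add_atTop_nhds_zero_nat (𝕜 := ℝ))
  have h1 : Tendsto (fun n => (z (θ n)).1) atTop (𝓝 φ) := (continuous_fst.tendsto _).comp hlim
  have h2 : Tendsto (fun n => (z (θ n)).2) atTop (𝓝 c) := (continuous_snd.tendsto _).comp hlim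
  have h3 : Tendsto (fun n => fun s => β (θ n) * (z (θ n)).1 s) atTop (𝓝 φ) := by
    rw [tendsto_pi_nhds] at h1 ⊢
    intro s
    simpa using (hβ.comp hθ.tendsto_atTop).mul (h1 s)
  have h4 := ((lipschitzWith_shapley G i).continuous.tendsto φ).comp h3
  have h5 : Tendsto (fun n => fun s => (z (θ n)).1 s + (z (θ n)).2) atTop
      (𝓝 fun s => φ s + c) := by
    rw [tendsto_pi_nhds] at h1 ⊢
    exact fun s => (h1 s).add h2
  refine tendsto_nhds_unique h4 ?_
  simpa only [Function.comp_def, heq] using h5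

end Potential
end AltMove

/-! ### Securing the value. -/

namespace AltMove
universe v
variable {k : ℕ} [NeZero k] {A : Fin k → Type v} [∀ i, Fintype (A i)]

section Main
variable [∀ i, Nonempty (A i)]

theorem utility_eq_liminf (G : Game A) (σ : Profile A) (i : Fin k) :
    utility G σ i = liminf (fun n : ℕ => expect σ n (idealTotal G i n) / n) atTop := by
  have h := tendsto_avgPayoff_sub G σ i
  have h1 : ∀ n, |avgPayoff G σ i n| ≤ 1 + k := fun n => by
    have e1 := abs_avgPayoff_sub_le G σ i n
    have e2 := abs_expect_idealTotal_div_le G σ i n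
    have e3 : (k : ℝ) / n ≤ k := by
      rcases n.eq_zero_or_pos with rfl | hn
      · simp
      · exact div_le_self (Nat.cast_nonneg k) (by exact_mod_cast hn)
    rw [abs_le] at *
    constructor <;> linarith
  refine le_antisymm
    (liminf_le_liminf_of_le_add h1 (abs_expect_idealTotal_div_le G σ i) h
      (Eventually.of_forall fun n => by linarith))
    (liminf_le_liminf_of_le_add (abs_expect_idealTotal_div_le G σ i) h1
      (e := fun n => -(avgPayoff G σ i n - expect σ n (idealTotal G i n) / n))
      (by simpa using h.neg) (Eventually.of_forall fun n => by linarith))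

theorem idealTotal_succ (G : Game A) (i : Fin k) (t : ℕ) (h : History A t) (a : A (mover k t)) :
    idealTotal G i (t + 1) (h, a) = idealTotal G i t h + G.u i (vec (A := A) (t + 1) (h, a)) := rfl

theorem exists_abs_le (φ : Position A → ℝ) : ∃ B, 0 ≤ B ∧ ∀ s, |φ s| ≤ B :=
  ⟨‖φ‖, norm_nonneg _, fun s => norm_le_pi_norm φ s⟩

/-- Player `i` can secure the value of the optimality equation against any profile. -/
theorem exists_deviation (G : Game A) (σ : Profile A) (i : Fin k) {φ : Position A → ℝ} {c : ℝ}
    (H : shapley G i φ = fun s => φ s + c) :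
    ∃ τ : Strategy A i, c ≤ utility G (Function.update σ i τ) i := by
  choose best hbest using fun a => exists_eq_shapley G i i φ a
  let τ : Strategy A i := fun t _ h => PMF.pure (best (vec t h))
  obtain ⟨B, hB0, hB⟩ := exists_abs_le φ
  refine ⟨τ, ?_⟩
  set ρ := Function.update σ i τ with hρ
  have hsupp : ∀ t h j (hj : mover k t = j), j = i → ∀ a ∈ (ρ j t hj h).support,
      moveValue G i φ j (vec t h) a = shapley G i φ (j, vec t h) := by
    rintro t h j hj rfl a ha
    have ha : a ∈ (PMF.pure (best (vec t h))).support := by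
      simpa only [hρ, Function.update_self] using ha
    rw [(PMF.mem_support_pure_iff _ _).mp ha]
    exact hbest _
  -- `c * t - idealTotal - φ` is a supermartingale: `i` attains `φ + c` at his turns, and no
  -- opponent's move gets below it.
  have hstep : ∀ t, expect ρ t (fun h => c * t - idealTotal G i t h - φ (mover k t, vec t h)) ≤
      B := by
    intro t
    induction t with
    | zero =>
      rw [← expect_const ρ 0 B]
      refine expect_mono ρ 0 fun h _ => ?_
      have := (abs_le.mp (hB (mover k 0, vec 0 h))).1
      simp only [idealTotal, Nat.cast_zero, mul_zero]
      linarith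
    | succ t ih =>
      refine (expect_succ_le ρ t fun h _ a ha => ?_).trans ih
      have e : shapley G i φ (mover k t, vec t h) ≤ moveValue G i φ (mover k t) (vec t h) a := by
        by_cases hi : mover k t = i
        · exact (hsupp t h _ rfl hi a ha).ge
        · exact shapley_le G hi φ _ a
      rw [H, moveValue] at e
      rw [idealTotal_succ, vec_succ, mover_succ]
      push_cast
      linarith
  rw [utility_eq_liminf]
  have hlim : Tendsto (fun n : ℕ => 2 * B / n) atTop (𝓝 0) :=
    tendsto_const_div_atTop_nhds_zero_nat _
  have hle := liminf_le_liminf_of_le_add (f := fun _ => c) (c := |c|) (fun _ => le_rfl)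
    (abs_expect_idealTotal_div_le G ρ i) hlim ?_
  · simpa using hle
  filter_upwards [eventually_ge_atTop 1] with n hn
  have hn0 : (0 : ℝ) < n := by exact_mod_cast hn
  rw [← add_div, le_div_iff₀ hn0]
  have e1 : expect ρ n (fun h => c * n + (-1) * idealTotal G i n h) ≤
      expect ρ n (fun h => (c * n - idealTotal G i n h - φ (mover k n, vec n h)) + B) :=
    expect_mono ρ n fun h _ => by linarith [(abs_le.mp (hB (mover k n, vec n h))).2]
  rw [expect_add, expect_add, expect_mul ρ n (-1), expect_const, expect_const] at e1
  linarith [hstep n]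

/-! ### Deterministic paths and first deviators. -/

/-- The history in which in every round `t` the mover `j` plays `α t j`. -/
def path {A : Fin k → Type v} (α : ℕ → ∀ j, A j) : ∀ t, History A t
  | 0 => PUnit.unit
  | t + 1 => (path α t, α t (mover k t))

open Classical in
/-- The first player who deviates from `path α` along a history. -/
noncomputable def deviator {A : Fin k → Type v} (α : ℕ → ∀ j, A j) :
    ∀ t, History A t → Option (Fin k)
  | 0, _ => none
  | t + 1, h => (deviator α t h.1).or
      (if h.2 = α t (mover k t) then none else some (mover k t))

open Classical in
theorem deviator_succ (α : ℕ → ∀ j, A j) (t : ℕ) (h : History A t) (a : A (mover k t)) :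
    deviator (A := A) α (t + 1) (h, a) = (deviator α t h).or
      (if a = α t (mover k t) then none else some (mover k t)) := rfl

theorem deviator_path (α : ℕ → ∀ j, A j) (t : ℕ) : deviator α t (path α t) = none := by
  induction t with
  | zero => rfl
  | succ t ih =>
    rw [path, deviator_succ, ih]
    simp

theorem eq_path_of_deviator (α : ℕ → ∀ j, A j) :
    ∀ (t : ℕ) (h : History A t), deviator α t h = none → h = path α t := by
  intro t
  induction t with
  | zero => intro h _; rfl
  | succ t ih =>
    rintro ⟨h, a⟩ H
    rw [deviator_succ, Option.or_eq_none_iff] at H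
    have h2 : a = α t (mover k t) := by
      by_contra hne
      exact absurd H.2 (by simp [hne])
    rw [path, ← ih h H.1, ← h2]

theorem vec_path (α : ℕ → ∀ j, A j) (a : ∀ j, A j) (t m : ℕ)
    (hα : ∀ l, t ≤ l → l < t + m → α l = a) (j : Fin k) :
    (∃ l, t ≤ l ∧ l < t + m ∧ mover k l = j) → vec (t + m) (path α (t + m)) j = a j := by
  induction m with
  | zero => rintro ⟨l, h1, h2, _⟩; omega
  | succ m ih =>
    rintro ⟨l, h1, h2, hl⟩
    change vec (t + m + 1) (path α (t + m), α (t + m) (mover k (t + m))) j = a j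
    rw [vec_succ, hα (t + m) (by omega) (by omega)]
    by_cases hj : j = mover k (t + m)
    · subst hj
      rw [Function.update_self]
    · rw [Function.update_of_ne hj]
      refine ih (fun l h1 h2 => hα l h1 (by omega)) ⟨l, h1, ?_, hl⟩
      by_contra hcon
      obtain rfl : l = t + m := by omega
      exact hj hl.symm

/-- Any `2k` consecutive rounds contain a full cycle starting at a multiple of `k`. -/
theorem vec_path_eq (α : ℕ → ∀ j, A j) (a : ∀ j, A j) (t : ℕ)
    (hα : ∀ l, t ≤ l → l < t + 2 * k → α l = a) : vec (t + 2 * k) (path α (t + 2 * k)) = a := by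
  funext j
  refine vec_path α a t (2 * k) hα j ⟨j.val + k * (t / k + 1), ?_, ?_, ?_⟩
  · have := Nat.lt_mul_div_succ t (NeZero.pos k)
    omega
  · have h1 := Nat.mul_div_le t k
    have h2 := j.isLt
    rw [mul_add]
    omega
  · rw [mover_add_mul, mover_val]

theorem idealTotal_path (G : Game A) (i : Fin k) (α : ℕ → ∀ j, A j) (n : ℕ) :
    idealTotal G i n (path α n) =
      ∑ t ∈ Finset.range n, G.u i (vec (t + 1) (path α (t + 1))) := by
  induction n with
  | zero => rfl
  | succ n ih =>
    rw [Finset.sum_range_succ, ← ih]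
    rfl

theorem exists_path_approximation (G : Game A) (σ : Profile A) :
    ∃ α : ℕ → ∀ j, A j, ∀ i, Tendsto (fun n : ℕ =>
      expect σ n (idealTotal G i n) / n - idealTotal G i n (path α n) / n) atTop (𝓝 0) := by
  have hx : ∀ t i, |expect σ (t + 1) fun h => G.u i (vec (t + 1) h)| ≤ 1 := fun t i =>
    abs_expect_le σ _ fun h => abs_u_le G i _
  obtain ⟨b, hb⟩ := exists_block_approximation (fun i a => G.u i a) (fun i a => abs_u_le G i a)
    (fun t i => expect σ (t + 1) fun h => G.u i (vec (t + 1) h)) hx (by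
      intro t D
      obtain ⟨a, ha⟩ := Finite.exists_max fun a : ∀ j, A j => ∑ i, D i * G.u i a
      refine ⟨a, ?_⟩
      simp only [← expect_mul]
      rw [← expect_sum, ← expect_const σ (t + 1) (∑ i, D i * G.u i a)]
      exact expect_mono σ _ fun h _ => ha _)
  refine ⟨fun t => b (Nat.sqrt t), fun i => ?_⟩
  set α : ℕ → ∀ j, A j := fun t => b (Nat.sqrt t) with hα
  -- The realised vector is the intended one as soon as the last `2k` rounds lie in one block.
  have hterm : ∀ t, |G.u i (b (Nat.sqrt t)) - G.u i (vec (t + 1) (path α (t + 1)))| ≤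
      if t < 2 * k ∨ Nat.sqrt (t - 2 * k) ≠ Nat.sqrt t then 2 else 0 := by
    intro t
    split_ifs with ht
    · have h1 := abs_sub (G.u i (b (Nat.sqrt t))) (G.u i (vec (t + 1) (path α (t + 1))))
      have h2 := abs_u_le G i (b (Nat.sqrt t))
      have h3 := abs_u_le G i (vec (t + 1) (path α (t + 1)))
      linarith
    · push Not at ht
      have h1 := vec_path_eq α (b (Nat.sqrt t)) (t + 1 - 2 * k) (fun l h1 h2 => by
        have e1 : Nat.sqrt l ≤ Nat.sqrt t := Nat.sqrt_le_sqrt (by omega)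
        have e2 : Nat.sqrt (t - 2 * k) ≤ Nat.sqrt l := Nat.sqrt_le_sqrt (by omega)
        rw [hα]
        simp only
        congr 1
        omega)
      rw [show t + 1 - 2 * k + 2 * k = t + 1 by omega] at h1
      rw [h1]
      simp
  have hsecond : Tendsto (fun n : ℕ => (∑ t ∈ Finset.range n,
      (G.u i (b (Nat.sqrt t)) - G.u i (vec (t + 1) (path α (t + 1))))) / n) atTop (𝓝 0) := by
    have hlim := (tendsto_card_sqrt_ne_div (2 * k)).mul_const 2
    rw [zero_mul] at hlim
    refine squeeze_zero_norm (fun n => ?_) hlim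
    rw [Real.norm_eq_abs, abs_div, Nat.abs_cast, div_mul_eq_mul_div]
    refine div_le_div_of_nonneg_right ?_ (Nat.cast_nonneg n)
    refine (Finset.abs_sum_le_sum_abs _ _).trans ((Finset.sum_le_sum fun t _ => hterm t).trans ?_)
    rw [← Finset.sum_filter, Finset.sum_const, nsmul_eq_mul]
  have := (hb i).add hsecond
  rw [add_zero] at this
  refine this.congr fun n => ?_
  rw [expect_idealTotal, idealTotal_path, ← add_div, ← sub_div, ← Finset.sum_add_distrib,
    ← Finset.sum_sub_distrib]
  simp

/-! ### Trigger profiles and their deviations. -/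

/-- The pure profile in which everybody follows `path α` until somebody deviates, and then plays
optimally in the zero-sum game against the first deviator. -/
noncomputable def triggerProfile {A : Fin k → Type v} [∀ i, Nonempty (A i)]
    (α : ℕ → ∀ j, A j) (punish : Fin k → ∀ j, (∀ j, A j) → A j) : Profile A :=
  fun j t _ h => PMF.pure ((deviator α t h).elim (α t j) fun d => punish d j (vec t h))

theorem playDist_triggerProfile (α : ℕ → ∀ j, A j)
    (punish : Fin k → ∀ j, (∀ j, A j) → A j) (t : ℕ) :
    playDist (triggerProfile α punish) t = PMF.pure (path α t) := by
  induction t with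
  | zero => rfl
  | succ t ih =>
    rw [playDist, ih, PMF.pure_bind, triggerProfile, deviator_path]
    exact PMF.pure_map _ _

theorem expect_triggerProfile (α : ℕ → ∀ j, A j) (punish : Fin k → ∀ j, (∀ j, A j) → A j)
    (t : ℕ) (f : History A t → ℝ) : expect (triggerProfile α punish) t f = f (path α t) := by
  classical
  rw [expect, playDist_triggerProfile, Finset.sum_eq_single (path α t)]
  · simp
  · intro h _ hh
    simp [PMF.pure_apply, hh]
  · intro h
    exact absurd (Finset.mem_univ _) h

/-- Before any deviation the other players follow the path, so only `i` can be the first to leave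
it. -/
theorem deviator_of_mem_support (α : ℕ → ∀ j, A j) (punish : Fin k → ∀ j, (∀ j, A j) → A j)
    (i : Fin k) (τ : Strategy A i) : ∀ (t : ℕ) (h : History A t),
    h ∈ (playDist (Function.update (triggerProfile α punish) i τ) t).support →
      deviator α t h = none ∨ deviator α t h = some i := by
  intro t
  induction t with
  | zero => intro h _; exact Or.inl rfl
  | succ t ih =>
    rintro ⟨h, a⟩ H
    obtain ⟨hh, ha⟩ := mem_support_succ _ t h a H
    rw [deviator_succ]
    rcases ih h hh with e | e
    · rw [e, Option.none_or]
      by_cases hi : mover k t = i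
      · split_ifs <;> simp [hi]
      · rw [Function.update_of_ne hi] at ha
        simp only [triggerProfile, PMF.support_pure, Set.mem_singleton_iff, e,
          Option.elim_none] at ha
        simp [ha]
    · rw [e]
      simp

/-- No player gains more by deviating from a trigger profile than the larger of his utility along
the path and his value in the zero-sum game. -/
theorem utility_update_triggerProfile_le (G : Game A) (α : ℕ → ∀ j, A j)
    (punish : Fin k → ∀ j, (∀ j, A j) → A j) (i : Fin k) {φ : Position A → ℝ} {c : ℝ}
    (hc : |c| ≤ 1) (H : shapley G i φ = fun s => φ s + c)
    (hpunish : ∀ j a, moveValue G i φ j a (punish i j a) = shapley G i φ (j, a))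
    (hle : c ≤ utility G (triggerProfile α punish) i) (τ : Strategy A i) :
    utility G (Function.update (triggerProfile α punish) i τ) i ≤
      utility G (triggerProfile α punish) i := by
  classical
  obtain ⟨B, hB0, hB⟩ := exists_abs_le φ
  rw [utility_eq_liminf] at hle ⊢
  rw [utility_eq_liminf]
  simp only [expect_triggerProfile] at hle ⊢
  have hdev := deviator_of_mem_support α punish i τ
  set ρ := Function.update (triggerProfile α punish) i τ with hρ
  have hsupp : ∀ t h, deviator α t h = some i → ∀ a ∈ (ρ (mover k t) t rfl h).support,
      moveValue G i φ (mover k t) (vec t h) a ≤ shapley G i φ (mover k t, vec t h) := by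
    intro t h hd a ha
    by_cases hi : mover k t = i
    · clear_value ρ
      clear hdev hpunish ha
      revert a
      generalize vec t h = y
      intro a
      revert a
      rw [hi]
      exact fun a => le_shapley G φ y a
    · rw [hρ, Function.update_of_ne hi] at ha
      simp only [triggerProfile, PMF.support_pure, Set.mem_singleton_iff, hd,
        Option.elim_some] at ha
      rw [ha, hpunish]
  let on : ∀ t, History A t → ℝ := fun t h => if deviator α t h = none then 1 else 0
  -- The probability that no deviation has occurred before round `t`.
  let q : ℕ → ℝ := fun t => expect ρ t (on t)
  -- After a deviation `Y` is a supermartingale by the punishment. Before it, `2t + B` bounds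
  -- whatever value `Y` can take if the deviation happens at the next step, and growing by 2 per
  -- round costs `2 * q t` in expectation.
  let Y : ∀ t, History A t → ℝ := fun t h => if deviator α t h = none then 2 * t + B else
    idealTotal G i t h + φ (mover k t, vec t h) - c * t
  have hc' := abs_le.mp hc
  have hY : ∀ n, expect ρ n (Y n) ≤ B + 2 * ∑ t ∈ Finset.range n, q t := by
    intro n
    induction n with
    | zero =>
      have : Y 0 = fun _ => B := by
        funext h
        simp [Y, deviator]
      rw [this, expect_const]
      simp
    | succ t ih =>
      have e : expect ρ (t + 1) (Y (t + 1)) ≤ expect ρ t (fun h => Y t h + 2 * on t h) := by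
        refine expect_succ_le ρ t fun h hh a ha => ?_
        rcases hdev t h hh with hd | hd
        · have hR : Y t h + 2 * on t h = 2 * t + B + 2 := by simp [Y, on, hd]
          rw [hR]
          simp only [Y]
          split_ifs with h2
          · push_cast
            linarith
          · have e1 := (abs_le.mp (abs_idealTotal_le G i (t + 1) (h, a))).2
            have e2 := (abs_le.mp (hB (mover k (t + 1), vec (A := A) (t + 1) (h, a)))).2
            have e3 : -c * ((t + 1 : ℕ) : ℝ) ≤ 1 * ((t + 1 : ℕ) : ℝ) :=
              mul_le_mul_of_nonneg_right (by linarith) (Nat.cast_nonneg _)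
            push_cast at *
            linarith
        · have hd2 : deviator (A := A) α (t + 1) (h, a) ≠ none := by
            rw [deviator_succ, hd]
            simp
          have e1 := hsupp t h hd a ha
          rw [H, moveValue] at e1
          simp only [Y, on, hd, if_neg hd2, idealTotal_succ, vec_succ, mover_succ]
          push_cast
          simp
          linarith
      rw [expect_add, expect_mul] at e
      rw [Finset.sum_range_succ]
      linarith
  have hq0 : ∀ t, 0 ≤ q t := fun t => by
    rw [← expect_const ρ t 0]
    refine expect_mono ρ t fun h _ => ?_
    simp only [on]
    split_ifs <;> norm_num
  have hq1 : ∀ t, q t ≤ 1 := fun t => by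
    rw [← expect_const ρ t 1]
    refine expect_mono ρ t fun h _ => ?_
    simp only [on]
    split_ifs <;> norm_num
  have hanti : Antitone q := antitone_nat_of_succ_le fun t => by
    refine expect_succ_le ρ t fun h _ a _ => ?_
    simp only [on]
    by_cases hd : deviator α t h = none
    · rw [if_pos hd]
      split_ifs <;> norm_num
    · have hd2 : deviator (A := A) α (t + 1) (h, a) ≠ none := by
        rw [deviator_succ]
        simp [hd]
      rw [if_neg hd, if_neg hd2]
  obtain ⟨r, hr⟩ : ∃ r, Tendsto q atTop (𝓝 r) :=
    ⟨_, tendsto_atTop_ciInf hanti ⟨0, by rintro _ ⟨t, rfl⟩; exact hq0 t⟩⟩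
  have hr0 : 0 ≤ r := ge_of_tendsto' hr hq0
  set p : ℕ → ℝ := fun n => idealTotal G i n (path α n) / n with hp
  have hp1 : ∀ n, |p n| ≤ 1 := fun n => by
    rw [hp]
    simp only
    rw [abs_div, Nat.abs_cast]
    exact div_le_one_of_le₀ (abs_idealTotal_le G i n _) (Nat.cast_nonneg n)
  have hbound : ∀ n, expect ρ n (idealTotal G i n) ≤ 2 * B + 2 * ∑ t ∈ Finset.range n, q t +
      q n * (idealTotal G i n (path α n) - 2 * n) + (1 - q n) * (c * n) := by
    intro n
    have e : expect ρ n (idealTotal G i n) ≤ expect ρ n (fun h => Y n h +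
        ((idealTotal G i n (path α n) - 2 * n - c * n - 2 * B) * on n h + (c * n + B))) := by
      refine expect_mono ρ n fun h _ => ?_
      by_cases hd : deviator α n h = none
      · have := eq_path_of_deviator α n h hd
        simp only [Y, on, hd, if_true]
        rw [this]
        linarith
      · simp only [Y, on, hd, if_false]
        linarith [(abs_le.mp (hB (mover k n, vec n h))).1]
    rw [expect_add, expect_add, expect_mul, expect_const] at e
    have e2 : 0 ≤ B * q n := mul_nonneg hB0 (hq0 n)
    have e3 := hY n
    change _ ≤ _ + (_ * q n + _) at e
    linarith
  -- The cost of the time spent before deviating is the Cesàro mean of `q` minus `q n`; it vanishes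
  -- because the decreasing `q` converges.
  let e : ℕ → ℝ := fun n => 2 * B / n + 2 * ((n : ℝ)⁻¹ * ∑ t ∈ Finset.range n, q t - q n) +
    (q n - r) * (p n - c)
  have he : Tendsto e atTop (𝓝 0) := by
    have e1 : Tendsto (fun n : ℕ => 2 * B / n) atTop (𝓝 0) :=
      tendsto_const_div_atTop_nhds_zero_nat _
    have e2 := (hr.cesaro.sub hr).const_mul 2
    have e3 : Tendsto (fun n => (q n - r) * (p n - c)) atTop (𝓝 0) := by
      have e4 : Tendsto (fun n => |q n - r| * 2) atTop (𝓝 0) := by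
        simpa using ((hr.sub_const r).abs).mul_const 2
      refine squeeze_zero_norm (fun n => ?_) e4
      rw [Real.norm_eq_abs, abs_mul]
      refine mul_le_mul_of_nonneg_left ?_ (abs_nonneg _)
      linarith [abs_sub (p n) c, hp1 n]
    simpa [e] using (e1.add e2).add e3
  let f : ℝ → ℝ := fun x => r * x + (1 - r) * c
  have hf : Monotone f := fun x y hxy => by
    simp only [f]
    linarith [mul_le_mul_of_nonneg_left hxy hr0]
  have hr1 : r ≤ 1 := le_of_tendsto' hr hq1
  obtain ⟨hb1, hb2⟩ := isBoundedUnder_of_abs_le hp1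
  -- An increasing affine map commutes with liminf, so the bound becomes a convex combination of the
  -- path's utility and `c`, the latter being no larger.
  have hmap : f (liminf p atTop) = liminf (f ∘ p) atTop :=
    hf.map_liminf_of_continuousAt p (by fun_prop) hb1.isCoboundedUnder_ge hb2
  have hfp : ∀ n, |(f ∘ p) n| ≤ 1 := fun n => by
    have h1 := abs_le.mp (hp1 n)
    simp only [f, Function.comp_apply]
    rw [abs_le]
    constructor <;> nlinarith
  have hfinal := liminf_le_liminf_of_le_add (abs_expect_idealTotal_div_le G ρ i) hfp he (by
    filter_upwards [eventually_ge_atTop 1] with n hn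
    have hn0 : (0 : ℝ) < n := by exact_mod_cast hn
    rw [div_le_iff₀ hn0]
    refine (hbound n).trans (le_of_eq ?_)
    have hpn : idealTotal G i n (path α n) = p n * n := by
      rw [hp]
      field_simp
    rw [hpn]
    simp only [f, e, Function.comp_apply]
    field_simp
    ring)
  refine hfinal.trans ?_
  rw [← hmap]
  simp only [f]
  nlinarith [mul_nonneg (sub_nonneg.mpr hr1) (sub_nonneg.mpr hle)]

end Main
end AltMove

/-! ### Conclusion. -/

theorem mainTheorem3 {k : ℕ} [NeZero k] (A : Fin k → Type*) [∀ i, Fintype (A i)]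
    (G : AltMove.Game A) (σ : AltMove.Profile A) (t : Fin k → ℝ)
    (ht : AltMove.utility G σ = t) :
    ∃ σ' : AltMove.Profile A,
      (∀ i, (σ' i).IsPure) ∧
      AltMove.utility G σ' = t ∧
      (AltMove.IsEquilibrium G σ → AltMove.IsEquilibrium G σ') := by
  classical
  have : ∀ i, Nonempty (A i) := AltMove.nonempty_of_profile σ
  obtain ⟨α, hα⟩ := AltMove.exists_path_approximation G σ
  choose φ c hc hφ using AltMove.exists_optimality_equation G
  choose punish hpunish using fun d j a => AltMove.exists_eq_shapley G d j (φ d) a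
  have hu : AltMove.utility G (AltMove.triggerProfile α punish) = AltMove.utility G σ := by
    funext i
    rw [AltMove.utility_eq_liminf, AltMove.utility_eq_liminf]
    have h1 := AltMove.abs_expect_idealTotal_div_le G σ i
    have h2 := AltMove.abs_expect_idealTotal_div_le G (AltMove.triggerProfile α punish) i
    simp only [AltMove.expect_triggerProfile] at h2 ⊢
    refine le_antisymm
      (AltMove.liminf_le_liminf_of_le_add h2 h1 (by simpa using (hα i).neg)
        (Filter.Eventually.of_forall fun n => ?_))
      (AltMove.liminf_le_liminf_of_le_add h1 h2 (hα i)
        (Filter.Eventually.of_forall fun n => ?_))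
    · linarith
    · linarith
  refine ⟨AltMove.triggerProfile α punish, fun i n hn h => ⟨_, rfl⟩, hu.trans ht,
    fun heq i τ => ?_⟩
  refine AltMove.utility_update_triggerProfile_le G α punish i (hc i) (hφ i) (hpunish i) ?_ τ
  -- Equilibrium of `σ` is used only here: securing `c i` is one of the deviations it makes
  -- unprofitable.
  obtain ⟨τ', hτ'⟩ := AltMove.exists_deviation G σ i (hφ i)
  rw [hu]
  exact hτ'.trans (heq i τ')
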